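/- All graphs are finite and simple. For a graph $G$, let $K_G$ denote the complete graph on the vertex set of $G$, and call a perfect matching of $K_G$ a pairing of $G$. A graph $G$ has the Pairing-Hamiltonian property (PH-property) if it has even order and for every pairing $M$ of $G$ there is a perfect matching $N$ of $G$ such that $M\cup N$ is the edge set of a Hamiltonian cycle of $K_G$. The prism of $G$ is the Cartesian product $\mathcal{P}(G)=G\,\Box\,K_2$, and the iterated prisms are defined by $\mathcal{P}^0(G)=G$ and $\mathcal{P}^k(G)=\mathcal{P}(\mathcal{P}^{k-1}(G))$ for $k\ge 1$. Let $G$ be a traceable graph, that is, a graph admitting a Hamiltonian path. Then, for every $k\ge 5$, the graph $\mathcal{P}^k(G)$ has the PH-property. -/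

import Mathlib

open scoped Classical in
/-- A graph is traceable if it admits a Hamiltonian path. -/
def SimpleGraph.IsTraceable {V : Type*} (G : SimpleGraph V) : Prop :=
  ∃ (u v : V) (p : G.Walk u v), p.IsHamiltonian

open scoped Classical in
/-- The Pairing-Hamiltonian property: the graph has even order and every pairing `M` (perfect
matching of the complete graph on the vertex set of `G`) admits a perfect matching `N` of `G`
such that `M ∪ N` is the edge set of a Hamiltonian cycle of that complete graph. -/
def SimpleGraph.HasPHProperty {V : Type*} (G : SimpleGraph V) : Prop :=
  Even (Nat.card V) ∧
    ∀ M : (completeGraph V).Subgraph, M.IsPerfectMatching →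
      ∃ N : G.Subgraph, N.IsPerfectMatching ∧
        ∃ (v : V) (C : (completeGraph V).Walk v v), C.IsHamiltonianCycle ∧
          M.edgeSet ∪ N.edgeSet = C.edgeSet

/-- The prism of `G`: the Cartesian product of `G` with the complete graph on two vertices. -/
def SimpleGraph.prism {V : Type*} (G : SimpleGraph V) : SimpleGraph (V × Bool) :=
  G.boxProd (completeGraph Bool)

/-- The vertex type of the `k`-th iterated prism of a graph on `V`. -/
def PrismVertex (V : Type*) : ℕ → Type _
  | 0 => V
  | k + 1 => PrismVertex V k × Bool

/-- The `k`-th iterated prism of `G`, with the zeroth one equal to `G`. -/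
def SimpleGraph.prismPow {V : Type*} (G : SimpleGraph V) :
    (k : ℕ) → SimpleGraph (PrismVertex V k)
  | 0 => G
  | k + 1 => (G.prismPow k).prism

/-! The union of two pairings on at least three vertices is a Hamiltonian cycle exactly when it is
connected. The PH-property thus becomes `PairJoin`: every pairing is connected by one that runs
along edges. This survives adding edges and, in even order, taking the prism (`PairJoin.prism`). It
therefore suffices to treat the third prism, which is spanned by the strip `P □ Q₃`, where `P` is a
Hamiltonian path of `G` and `Q₃` is the cube.

The strip is solved column by column. If the pairing has a pair between the first column and the
rest, a parity argument lets the two blocks be filled one after the other (`exists_joins_sum_map`).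
Otherwise some vertices of the column are matched straight to the next one. There, the part already
built is felt only through which of these vertices it links: a partial pairing, whose pairs act as
virtual edges. Which partial pairing is useful depends on the columns still to come, so a whole set
of options is carried along.

A collection of such sets solves every strip by induction if it contains `{id}`, each of its sets
can finish a column, and each leads to another of its sets whatever the pairing of the column
(`IsClosedFamily.solves_stripRel`). For the cube, eight sets up to its 48 automorphisms suffice;
testing them against the 105 pairings of the cube is a finite computation (`checkFamily_eq_true`).
-/

/-- A pairing of a type, given as the map sending each element to its partner. -/
structure IsPairing {V : Type*} (m : V → V) : Prop where
  involutive : Function.Involutive m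
  ne : ∀ x, m x ≠ x

/-- Two maps jointly connect their domain: every equivalence relation respected by both of them
is trivial. -/
def Joins {V : Type*} (m n : V → V) : Prop :=
  ∀ t : Setoid V, (∀ x, t x (m x)) → (∀ x, t x (n x)) → ∀ x y, t x y

/-- Every pairing is joined by some pairing whose pairs are related by `R`. -/
def PairJoin {V : Type*} (R : V → V → Prop) : Prop :=
  ∀ m : V → V, IsPairing m → ∃ n, (IsPairing n ∧ ∀ x, R x (n x)) ∧ Joins m n

/-! ### Parity of sets closed under a pairing -/

section Parity

variable {V : Type*}

/-- Summing 1 over the pairs gives 0 modulo 2. -/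
theorem IsPairing.even_card [Finite V] {m : V → V} (hm : IsPairing m) : Even (Nat.card V) := by
  classical
  have := Fintype.ofFinite V
  have h : ∑ _x : V, (1 : ZMod 2) = 0 :=
    Finset.sum_involution (fun x _ => m x) (fun _ _ => by decide) (fun x _ _ => hm.ne x)
      (fun _ _ => Finset.mem_univ _) (fun x _ => hm.involutive x)
  rw [Nat.card_eq_fintype_card, even_iff_two_dvd, ← ZMod.natCast_eq_zero_iff]
  simpa using h

theorem IsPairing.even_card_subtype [Finite V] {m : V → V} (hm : IsPairing m) (p : V → Prop)
    (hp : ∀ x, p x → p (m x)) : Even (Nat.card {x // p x}) :=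
  IsPairing.even_card (m := Subtype.map m hp)
    ⟨fun x => Subtype.ext (hm.involutive x.1), fun x h => hm.ne x.1 (congrArg Subtype.val h)⟩

theorem IsPairing.conj {W : Type*} {m : V → V} (hm : IsPairing m) (e : V ≃ W) :
    IsPairing (e ∘ m ∘ e.symm) :=
  ⟨fun x => by simp [hm.involutive _], fun x h => hm.ne (e.symm x) (by
    simpa using congrArg e.symm h)⟩

theorem Joins.conj {W : Type*} {m n : V → V} (h : Joins m n) (e : V ≃ W) :
    Joins (e ∘ m ∘ e.symm) (e ∘ n ∘ e.symm) := by
  intro t hm hn x y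
  have := h (t.comap e) (fun x => by simpa [Setoid.comap_rel] using hm (e x))
    (fun x => by simpa [Setoid.comap_rel] using hn (e x)) (e.symm x) (e.symm y)
  simpa [Setoid.comap_rel] using this

theorem exists_isPairing_of_even [Finite V] (h : Even (Nat.card V)) :
    ∃ m : V → V, IsPairing m := by
  obtain ⟨k, hk⟩ := h
  obtain ⟨e⟩ : Nonempty (Fin k × Bool ≃ V) := Finite.card_eq.1 (by simp [hk, mul_two])
  have : IsPairing (fun p : Fin k × Bool => (p.1, !p.2)) :=
    ⟨fun p => by simp, fun p h => by simpa using congrArg Prod.snd h⟩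
  exact ⟨_, this.conj e⟩

/-- An equivalence relation with classes of even size admits a pairing of related elements. -/
theorem exists_isPairing_rel [Finite V] (t : Setoid V)
    (h : ∀ x, Even (Nat.card {y // t x y})) : ∃ m : V → V, IsPairing m ∧ ∀ x, t x (m x) := by
  have key : ∀ q : Quotient t, ∃ m : {y // ⟦y⟧ = q} → {y // ⟦y⟧ = q}, IsPairing m := by
    intro q
    induction q using Quotient.inductionOn with
    | h x =>
      apply exists_isPairing_of_even
      convert h x using 5 with y
      rw [Quotient.eq]
      exact ⟨t.symm, t.symm⟩
  choose g hg using key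
  -- The choice made for a class does not depend on how the class is named.
  have hm : ∀ q (y : {y : V // ⟦y⟧ = q}), (g ⟦y.1⟧ ⟨y.1, rfl⟩).1 = (g q y).1 := by
    rintro _ ⟨y, rfl⟩
    rfl
  refine ⟨fun x => (g ⟦x⟧ ⟨x, rfl⟩).1, ⟨fun x => ?_, fun x hx => ?_⟩, fun x => ?_⟩
  · rw [hm _ (g ⟦x⟧ ⟨x, rfl⟩), (hg _).involutive]
  · exact (hg ⟦x⟧).ne ⟨x, rfl⟩ (Subtype.ext hx)
  · exact t.symm (Quotient.exact (g ⟦x⟧ ⟨x, rfl⟩).2)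

end Parity

/-! ### Filling in blocks one after the other -/

section Merge

/-- If every class of an equivalence relation meets a block in a nonempty set of even size, then
the block can be filled in so that everything becomes connected. -/
theorem exists_merge {A W : Type*} [Finite A] (ι : A → W) (r : Setoid W) (P : (A → A) → Prop)
    (hP : ∀ m, IsPairing m → ∃ n, P n ∧ Joins m n) (hmeet : ∀ w, ∃ a, r w (ι a))
    (heven : ∀ a, Even (Nat.card {b // r (ι a) (ι b)})) :
    ∃ n, P n ∧ ∀ t : Setoid W, (∀ x y, r x y → t x y) → (∀ a, t (ι a) (ι (n a))) →
      ∀ x y, t x y := by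
  -- An auxiliary pairing inside the classes: whatever joins it also joins the classes.
  obtain ⟨m, hm, hr⟩ := exists_isPairing_rel (r.comap ι) heven
  obtain ⟨n, hn, hj⟩ := hP m hm
  refine ⟨n, hn, fun t ht hnt x y => ?_⟩
  obtain ⟨a, ha⟩ := hmeet x
  obtain ⟨b, hb⟩ := hmeet y
  exact t.trans (ht _ _ ha)
    (t.trans (hj (t.comap ι) (fun a => ht _ _ (hr a)) hnt a b) (t.symm (ht _ _ hb)))

variable {A B : Type*}

theorem card_subtype_sum [Finite A] [Finite B] (p : A ⊕ B → Prop) :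
    Nat.card {c // p c} = Nat.card {a // p (.inl a)} + Nat.card {b // p (.inr b)} := by
  rw [Nat.card_congr Equiv.subtypeSum, Nat.card_sum]

/-- Two blocks between which a pairing runs can be solved one after the other. -/
theorem exists_joins_sum_map [Finite A] [Finite B] {P : (A → A) → Prop} {P' : (B → B) → Prop}
    (hP : ∀ m, IsPairing m → ∃ n, P n ∧ Joins m n) (hPp : ∀ n, P n → IsPairing n)
    (hP' : ∀ m, IsPairing m → ∃ n, P' n ∧ Joins m n) (hB : Even (Nat.card B))
    {m : A ⊕ B → A ⊕ B} (hm : IsPairing m) {a₀ : A} {b₀ : B} (hab : m (.inl a₀) = .inr b₀) :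
    ∃ n n', P n ∧ P' n' ∧ Joins m (Sum.map n n') := by
  -- Contract `B` to a point and fill in `A` first.
  let r₁ : Setoid (A ⊕ B) := Relation.EqvGen.setoid fun x y =>
    y = m x ∨ ∃ b b', x = .inr b ∧ y = .inr b'
  have h₁m : ∀ x, r₁ x (m x) := fun x => .rel _ _ (.inl rfl)
  have h₁r : ∀ b b', r₁ (.inr b) (.inr b') := fun b b' => .rel _ _ (.inr ⟨b, b', rfl, rfl⟩)
  obtain ⟨n, hn, hn'⟩ := exists_merge (ι := (Sum.inl : A → A ⊕ B)) r₁ P hP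
    (by
      rintro (a | b)
      · exact ⟨a, r₁.refl _⟩
      · exact ⟨a₀, r₁.trans (h₁r b b₀) (hab ▸ r₁.symm (h₁m (.inl a₀)))⟩)
    (by
      intro a
      -- A class is closed under `m`, hence even, and it contains all of `B` or none of it; so its
      -- part in `A` is even.
      have h := hm.even_card_subtype (r₁ (.inl a)) fun x hx => r₁.trans hx (h₁m x)
      rw [card_subtype_sum, Nat.even_add] at h
      refine h.2 ?_
      by_cases hb : r₁ (.inl a) (.inr b₀)
      · convert hB using 1
        exact Nat.card_congr (Equiv.subtypeUnivEquiv fun b => r₁.trans hb (h₁r _ _))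
      · have : IsEmpty {b // r₁ (.inl a) (.inr b)} :=
          ⟨fun b => hb (r₁.trans b.2 (h₁r _ _))⟩
        simp)
  let r₂ : Setoid (A ⊕ B) := Relation.EqvGen.setoid fun x y =>
    y = m x ∨ ∃ a, x = .inl a ∧ y = .inl (n a)
  have h₂m : ∀ x, r₂ x (m x) := fun x => .rel _ _ (.inl rfl)
  have h₂n : ∀ a, r₂ (.inl a) (.inl (n a)) := fun a => .rel _ _ (.inr ⟨a, rfl, rfl⟩)
  let meets : A ⊕ B → Prop := fun x => ∃ b, r₂ x (.inr b)
  have hmeets : ∀ {x y}, r₂ x y → meets x → meets y := fun h ⟨b, hb⟩ =>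
    ⟨b, r₂.trans (r₂.symm h) hb⟩
  -- Merging all `r₂`-classes that meet `B` undoes the contraction, so `t` is total. Hence every
  -- `r₂`-class meets `B`.
  let t : Setoid (A ⊕ B) :=
    { r := fun x y => r₂ x y ∨ meets x ∧ meets y
      iseqv := ⟨fun x => .inl (r₂.refl x), by
        rintro x y (h | h)
        · exact .inl (r₂.symm h)
        · exact .inr h.symm, by
        rintro x y z (h | h) (h' | h')
        · exact .inl (r₂.trans h h')
        · exact .inr ⟨hmeets (r₂.symm h) h'.1, h'.2⟩
        · exact .inr ⟨h.1, hmeets h' h.2⟩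
        · exact .inr ⟨h.1, h'.2⟩⟩ }
  have ht : ∀ x y, t x y := by
    refine hn' t (fun x y h => ?_) fun a => .inl (h₂n a)
    refine Setoid.eqvGen_le (s := t) ?_ h
    rintro x y (rfl | ⟨b, b', rfl, rfl⟩)
    · exact .inl (h₂m x)
    · exact .inr ⟨⟨b, r₂.refl _⟩, b', r₂.refl _⟩
  obtain ⟨n', hn₂, hn₂'⟩ := exists_merge (ι := (Sum.inr : B → A ⊕ B)) r₂ P' hP'
    (fun w => (ht w (.inr b₀)).elim (fun h => ⟨b₀, h⟩) And.left)
    (by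
      intro b
      -- The class is even by `m` and its part in `A` is even by `n`, so its part in `B` is even.
      have h := hm.even_card_subtype (r₂ (.inr b)) fun x hx => r₂.trans hx (h₂m x)
      rw [card_subtype_sum, Nat.even_add] at h
      exact h.1 ((hPp n hn).even_card_subtype _ fun a ha => r₂.trans ha (h₂n a)))
  refine ⟨n, n', hn, hn₂, fun s hsm hsn => hn₂' s (fun x y h => ?_) fun b => hsn (.inr b)⟩
  refine Setoid.eqvGen_le (s := s) ?_ h
  rintro x y (rfl | ⟨a, rfl, rfl⟩)
  · exact hsm x
  · exact hsn (.inl a)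

end Merge

/-! ### Attaching two blocks; the prism step -/

section Attach

variable {A B : Type*}

/-- The relation on a sum that consists of a relation on each part and of the graph of a map. -/
def attachRel (R : A → A → Prop) (R' : B → B → Prop) (c : A → B) : A ⊕ B → A ⊕ B → Prop
  | .inl a, .inl a' => R a a'
  | .inr b, .inr b' => R' b b'
  | .inl a, .inr b => b = c a
  | .inr b, .inl a => b = c a

theorem IsPairing.sumMap {n : A → A} {n' : B → B} (h : IsPairing n) (h' : IsPairing n') :
    IsPairing (Sum.map n n') := by
  constructor
  · rintro (a | b)
    · exact congrArg Sum.inl (h.involutive a)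
    · exact congrArg Sum.inr (h'.involutive b)
  · rintro (a | b) hx
    · exact h.ne a (Sum.inl.inj hx)
    · exact h'.ne b (Sum.inr.inj hx)

/-- A pairing of a sum with no pair between the two parts splits. -/
theorem IsPairing.exists_eq_sumMap {m : A ⊕ B → A ⊕ B} (hm : IsPairing m)
    (h : ∀ a b, m (.inl a) ≠ .inr b) :
    ∃ m₀ m₁, IsPairing m₀ ∧ IsPairing m₁ ∧ m = Sum.map m₀ m₁ := by
  have h₀ : ∀ a, ∃ a', m (.inl a) = .inl a' := fun a => by
    rcases e : m (.inl a) with a' | b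
    · exact ⟨a', rfl⟩
    · exact (h a b e).elim
  have h₁ : ∀ b, ∃ b', m (.inr b) = .inr b' := fun b => by
    rcases e : m (.inr b) with a | b'
    · exact (h a b (by rw [← e, hm.involutive])).elim
    · exact ⟨b', rfl⟩
  choose m₀ hm₀ using h₀
  choose m₁ hm₁ using h₁
  refine ⟨m₀, m₁, ⟨fun a => ?_, fun a ha => ?_⟩, ⟨fun b => ?_, fun b hb => ?_⟩, ?_⟩
  · exact Sum.inl.inj (by rw [← hm₀, ← hm₀, hm.involutive])
  · exact hm.ne (.inl a) (by rw [hm₀, ha])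
  · exact Sum.inr.inj (by rw [← hm₁, ← hm₁, hm.involutive])
  · exact hm.ne (.inr b) (by rw [hm₁, hb])
  · funext x
    rcases x with a | b
    · exact hm₀ a
    · exact hm₁ b

theorem PairJoin.map {R : A → A → Prop} {R' : B → B → Prop} (h : PairJoin R) (e : A ≃ B)
    (he : ∀ x y, R x y → R' (e x) (e y)) : PairJoin R' := by
  intro m hm
  obtain ⟨n, ⟨hn, hR⟩, hj⟩ := h _ (hm.conj e.symm)
  refine ⟨_, ⟨hn.conj e, fun x => ?_⟩, ?_⟩
  · simpa using he _ _ (hR (e.symm x))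
  · convert hj.conj e using 1
    funext x
    simp

end Attach

/-- The prism over a relation that joins every pairing has the same property. -/
theorem PairJoin.prism {V : Type*} [Finite V] (hV : Even (Nat.card V))
    {R : V → V → Prop} (h : PairJoin R) : PairJoin (attachRel R R id) := by
  classical
  intro m hm
  by_cases hc : ∃ a b, m (.inl a) = .inr b
  · obtain ⟨a, b, hab⟩ := hc
    obtain ⟨n, n', hn, hn', hj⟩ := exists_joins_sum_map h (fun n hn => hn.1) h hV hm hab
    refine ⟨_, ⟨hn.1.sumMap hn'.1, ?_⟩, hj⟩
    rintro (x | x)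
    · exact hn.2 x
    · exact hn'.2 x
  push Not at hc
  obtain ⟨m₀, m₁, hm₀, hm₁, rfl⟩ := hm.exists_eq_sumMap hc
  obtain ⟨n, ⟨hn, hR⟩, hj⟩ := h m₀ hm₀
  -- The solution `n` for the first copy is repeated on the second, where `m₁` and `n` may form
  -- several cycles. In each of them one edge `{rep, n rep}` is replaced, in both copies, by the two
  -- vertical edges at its ends.
  let r : Setoid V := Relation.EqvGen.setoid fun x y => y = m₁ x ∨ y = n x
  have hrm : ∀ x, r x (m₁ x) := fun x => .rel _ _ (.inl rfl)
  have hrn : ∀ x, r x (n x) := fun x => .rel _ _ (.inr rfl)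
  let rep : V → V := fun x => (Quotient.mk r x).out
  have hrep : ∀ x, r (rep x) x := fun x => Quotient.exact (Quotient.out_eq _)
  have hrepn : ∀ x y, r x y → rep x = rep y := fun x y hxy =>
    congrArg Quotient.out (Quotient.sound hxy)
  let X : V → Prop := fun x => x = rep x ∨ n x = rep x
  have hX : ∀ x, X (n x) ↔ X x := fun x => by
    simp only [X, ← hrepn _ _ (hrn x), hn.involutive x]
    exact or_comm
  let ν : V ⊕ V → V ⊕ V := Sum.elim (fun x => if X x then .inr x else .inl (n x))
    (fun x => if X x then .inl x else .inr (n x))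
  have hν : ∀ x, ν (.inl x) = if X x then .inr x else .inl (n x) := fun _ => rfl
  have hν' : ∀ x, ν (.inr x) = if X x then .inl x else .inr (n x) := fun _ => rfl
  refine ⟨ν, ⟨⟨?_, ?_⟩, ?_⟩, ?_⟩
  · rintro (x | x) <;> by_cases hx : X x <;> simp [hν, hν', hx, hX, hn.involutive x]
  · rintro (x | x) <;> by_cases hx : X x <;> simp [hν, hν', hx, hn.ne]
  · rintro (x | x) <;> by_cases hx : X x <;> simp [hν, hν', hx, attachRel, hR]
  intro t htm htν
  have hver : ∀ x, X x → t (.inl x) (.inr x) := fun x hx => by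
    have := htν (.inl x)
    rwa [hν, if_pos hx] at this
  -- A cycle stays connected when one `n`-edge is deleted: otherwise the component `C` of `rep x` is
  -- even by `m₁`, while `C` without `rep x` is even by `n`.
  have hcyc : ∀ x, t (.inr (rep x)) (.inr (n (rep x))) := by
    intro x
    by_contra hcon
    let C : V → Prop := fun y => t (.inr (rep x)) (.inr y) ∧ r x y
    have h₁ := hm₁.even_card_subtype C fun y hy =>
      ⟨t.trans hy.1 (htm (.inr y)), r.trans hy.2 (hrm y)⟩
    have h₂ := hn.even_card_subtype (fun y => C y ∧ y ≠ rep x) fun y ⟨hy, hne⟩ => by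
      have hne' : n y ≠ rep x := fun h => hcon (by rw [← h, hn.involutive, h]; exact hy.1)
      have hXy : ¬ X y := by
        rintro (h | h)
        · exact hne (h.trans (hrepn _ _ hy.2).symm)
        · exact hne' (h.trans (hrepn _ _ hy.2).symm)
      refine ⟨⟨t.trans hy.1 ?_, r.trans hy.2 (hrn y)⟩, hne'⟩
      have := htν (.inr y)
      rwa [hν', if_neg hXy] at this
    have h₃ : Nat.card {y // C y ∧ y ≠ rep x} + 1 = Nat.card {y // C y} :=
      Set.ncard_sdiff_singleton_add_one (s := {y | C y}) (a := rep x)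
        ⟨t.refl _, r.symm (hrep x)⟩ (Set.toFinite _)
    rw [← h₃, Nat.even_add_one] at h₁
    exact h₁ h₂
  have hcyc' : ∀ x, t (.inr x) (.inr (n x)) := by
    intro x
    by_cases hx : X x
    · rcases hx with hx | hx
      · rw [hx]; exact hcyc x
      · have := hcyc x
        rw [← hx, hn.involutive] at this
        exact t.symm this
    · have := htν (.inr x)
      rwa [hν', if_neg hx] at this
  -- A deleted edge of the first copy is bypassed through the opened cycle above it.
  have hbot : ∀ x y, t (.inl x) (.inl y) := by
    refine hj (t.comap Sum.inl) (fun x => htm (.inl x)) fun x => ?_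
    by_cases hx : X x
    · exact t.trans (hver x hx) (t.trans (hcyc' x) (t.symm (hver _ ((hX x).2 hx))))
    · have := htν (.inl x)
      rwa [hν, if_neg hx] at this
  have htop : ∀ x, t (.inr x) (.inl x) := by
    intro x
    have h₁ : r ≤ t.comap Sum.inr := Setoid.eqvGen_le (by
      rintro x y (rfl | rfl)
      · exact htm (.inr x)
      · exact hcyc' x)
    have h₂ : X (rep x) := .inl (hrepn _ _ (hrep x)).symm
    exact t.trans (t.symm (h₁ (hrep x))) (t.trans (t.symm (hver _ h₂)) (hbot _ _))
  have key : ∀ z, ∃ x, t z (.inl x) := by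
    rintro (x | x)
    · exact ⟨x, t.refl _⟩
    · exact ⟨x, htop x⟩
  intro z w
  obtain ⟨x, hx⟩ := key z
  obtain ⟨y, hy⟩ := key w
  exact t.trans hx (t.trans (hbot x y) (t.symm hy))

/-! ### Solving a strip column by column -/

section Strip

variable {Q W : Type*}

/-- `n` is a pairing along `R`, except that on the copy `c` of `Q` it agrees with the partial
pairing `σ`. -/
def Extends (R : W → W → Prop) (c : Q → W) (σ : Q → Q) (n : W → W) : Prop :=
  IsPairing n ∧ (∀ a, σ a ≠ a → n (c a) = c (σ a)) ∧ ∀ x, (∀ a, σ a ≠ a → x ≠ c a) → R x (n x)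

/-- The pairing `m` of a column turns the partial pairing `σ` arriving at this column into the
partial pairing `σ'` arriving at the next one. -/
def ColumnStep (E : Q → Q → Prop) (m σ σ' : Q → Q) : Prop :=
  -- The vertices moved by `σ'` are those matched straight to the next column; `n` fixes them, so
  -- they are the ends of the alternating paths in this column.
  Function.Involutive σ' ∧ ∃ n, Function.Involutive n ∧ (∀ x, σ' x ≠ x → n x = x ∧ σ x = x) ∧
    (∀ x, σ' x = x → σ x ≠ x → n x = σ x) ∧ (∀ x, σ' x = x → σ x = x → E x (n x)) ∧
    ∀ t : Setoid Q, (∀ x, t x (m x)) → (∀ x, t x (n x)) →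
      (∀ x, t x (σ' x)) ∧ ∀ x, ∃ a, σ' a ≠ a ∧ t x a

/-- Every pairing is joined by an extension of some member of each family. -/
def Solves (F : Set (Set (Q → Q))) (R : W → W → Prop) (c : Q → W) : Prop :=
  ∀ S ∈ F, ∀ m, IsPairing m → ∃ σ ∈ S, ∃ n, Extends R c σ n ∧ Joins m n

theorem Solves.pairJoin {F : Set (Set (Q → Q))} {R : W → W → Prop} {c : Q → W}
    (h : Solves F R c) (hid : {id} ∈ F) : PairJoin R := by
  intro m hm
  obtain ⟨σ, rfl, n, hn, hj⟩ := h _ hid m hm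
  exact ⟨n, ⟨hn.1, fun x => hn.2.2 x fun a ha => (ha rfl).elim⟩, hj⟩

theorem Solves.map {W' : Type*} {F : Set (Set (Q → Q))} {R : W → W → Prop} {c : Q → W}
    (h : Solves F R c) (e : W ≃ W') {R' : W' → W' → Prop} {c' : Q → W'}
    (he : ∀ x y, R x y → R' (e x) (e y)) (hc : ∀ a, c' a = e (c a)) : Solves F R' c' := by
  intro S hS m hm
  obtain ⟨σ, hσ, n, ⟨hn, hnσ, hnR⟩, hj⟩ := h S hS _ (hm.conj e.symm)
  refine ⟨σ, hσ, _, ⟨hn.conj e, fun a ha => ?_, fun x hx => ?_⟩, ?_⟩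
  · simp [hc, hnσ a ha]
  · have := he _ _ (hnR (e.symm x) fun a ha h => hx a ha (by simp [hc, ← h]))
    simpa using this
  · convert hj.conj e using 1
    funext x
    simp

theorem Extends.sumMap {E : Q → Q → Prop} {R : W → W → Prop} {c : Q → W} {σ n : Q → Q}
    {n' : W → W} (hn : Extends E id σ n) (hn' : IsPairing n') (hR : ∀ x, R x (n' x)) :
    Extends (attachRel E R c) Sum.inl σ (Sum.map n n') := by
  refine ⟨hn.1.sumMap hn', fun a ha => congrArg Sum.inl (hn.2.1 a ha), ?_⟩
  rintro (x | x) hx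
  · exact hn.2.2 x fun a ha h => hx a ha (congrArg Sum.inl h)
  · exact hR x

/-- The virtual pairs `{c a, c (σ' a)}` of `n'` are removed. Each is replaced by the horizontal
edges at its two ends and the connection between `a` and `σ' a` inside the new column. -/
theorem ColumnStep.exists_extends {E : Q → Q → Prop} (hE : ∀ x, ¬ E x x) {R : W → W → Prop}
    {c : Q → W} (hc : Function.Injective c) {m₀ σ σ' : Q → Q} (h : ColumnStep E m₀ σ σ')
    {m₁ n' : W → W} (hn' : Extends R c σ' n') (hj : Joins m₁ n') :
    ∃ n, Extends (attachRel E R c) Sum.inl σ n ∧ Joins (Sum.map m₀ m₁) n := by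
  classical
  obtain ⟨hσ', n, hn, hnV, hnU, hnE, hnt⟩ := h
  let V : W → Prop := fun y => ∃ a, σ' a ≠ a ∧ c a = y
  have hV : ∀ a, V (c a) ↔ σ' a ≠ a := fun a =>
    ⟨fun ⟨b, hb, hba⟩ => hc hba ▸ hb, fun ha => ⟨a, ha, rfl⟩⟩
  have hV' : ∀ y, V (n' y) → V y := by
    rintro y ⟨a, ha, hay⟩
    refine ⟨σ' a, by rw [hσ']; exact ha.symm, ?_⟩
    rw [← hn'.2.1 a ha, hay, hn'.1.involutive]
  have hV'' : ∀ y, V (n' y) ↔ V y := fun y =>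
    ⟨hV' y, fun h => hV' _ (by rwa [hn'.1.involutive])⟩
  have hnσ' : ∀ a, σ' a = a → σ' (n a) = n a := fun a ha => by
    by_contra h
    have := (hnV _ h).1
    rw [hn] at this
    rw [← this] at h
    exact h ha
  have hne : ∀ a, σ' a = a → n a ≠ a := fun a ha h => by
    by_cases hs : σ a = a
    · exact hE a (by simpa [h] using hnE a ha hs)
    · exact hs (by rw [← hnU a ha hs, h])
  let ν : Q ⊕ W → Q ⊕ W := Sum.elim (fun a => if σ' a = a then .inl (n a) else .inr (c a))
    (fun y => if h : V y then .inl h.choose else .inr (n' y))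
  have hνl : ∀ a, σ' a = a → ν (.inl a) = .inl (n a) := fun a ha => if_pos ha
  have hνl' : ∀ a, σ' a ≠ a → ν (.inl a) = .inr (c a) := fun a ha => if_neg ha
  have hνr : ∀ y, ¬ V y → ν (.inr y) = .inr (n' y) := fun y hy => dif_neg hy
  have hνr' : ∀ a, σ' a ≠ a → ν (.inr (c a)) = .inl a := fun a ha => by
    have h : V (c a) := (hV a).2 ha
    have : ν (.inr (c a)) = .inl h.choose := dif_pos h
    rw [this, hc h.choose_spec.2]
  refine ⟨ν, ⟨⟨?_, ?_⟩, ?_, ?_⟩, ?_⟩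
  · rintro (a | y)
    · by_cases ha : σ' a = a
      · rw [hνl a ha, hνl _ (hnσ' a ha), hn]
      · rw [hνl' a ha, hνr' a ha]
    · by_cases hy : V y
      · obtain ⟨a, ha, rfl⟩ := hy
        rw [hνr' a ha, hνl' a ha]
      · rw [hνr y hy, hνr _ (by rwa [hV'']), hn'.1.involutive]
  · rintro (a | y)
    · by_cases ha : σ' a = a
      · rw [hνl a ha]
        exact fun h => hne a ha (Sum.inl.inj h)
      · simp [hνl' a ha]
    · by_cases hy : V y
      · obtain ⟨a, ha, rfl⟩ := hy
        simp [hνr' a ha]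
      · rw [hνr y hy]
        exact fun h => hn'.1.ne y (Sum.inr.inj h)
  · intro a ha
    have ha' : σ' a = a := by
      by_contra h
      exact ha (hnV a h).2
    rw [hνl a ha', hnU a ha' ha]
  · rintro (a | y) hx
    · have hs : σ a = a := by
        by_contra h
        exact hx a h rfl
      by_cases ha : σ' a = a
      · rw [hνl a ha]
        exact hnE a ha hs
      · rw [hνl' a ha]
        exact rfl
    · by_cases hy : V y
      · obtain ⟨a, ha, rfl⟩ := hy
        rw [hνr' a ha]
        exact rfl
      · rw [hνr y hy]
        exact hn'.2.2 y fun a ha h => hy ⟨a, ha, h.symm⟩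
  intro t htm htν
  have hver : ∀ a, σ' a ≠ a → t (.inl a) (.inr (c a)) := fun a ha => by
    have := htν (.inl a)
    rwa [hνl' a ha] at this
  obtain ⟨h₁, h₂⟩ := hnt (t.comap Sum.inl) (fun x => htm (.inl x)) (fun a => by
    by_cases ha : σ' a = a
    · have := htν (.inl a)
      rwa [hνl a ha] at this
    · rw [(hnV a ha).1])
  have h₃ : ∀ y y', t (.inr y) (.inr y') := by
    refine hj (t.comap Sum.inr) (fun y => htm (.inr y)) fun y => ?_
    by_cases hy : V y
    · obtain ⟨a, ha, rfl⟩ := hy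
      rw [hn'.2.1 a ha]
      exact t.trans (t.symm (hver a ha)) (t.trans (h₁ a)
        (hver (σ' a) (by rw [hσ']; exact ha.symm)))
    · have := htν (.inr y)
      rwa [hνr y hy] at this
  have key : ∀ z, ∃ y, t z (.inr y) := by
    rintro (x | y)
    · obtain ⟨a, ha, hxa⟩ := h₂ x
      exact ⟨c a, t.trans hxa (hver a ha)⟩
    · exact ⟨y, t.refl _⟩
  intro z w
  obtain ⟨x, hx⟩ := key z
  obtain ⟨y, hy⟩ := key w
  exact t.trans hx (t.trans (h₃ x y) (t.symm hy))

/-- Families of partial pairings that are closed under passing through a column. -/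
structure IsClosedFamily (E : Q → Q → Prop) (F : Set (Set (Q → Q))) : Prop where
  irrefl : ∀ x, ¬ E x x
  id_mem : {id} ∈ F
  finish : Solves F E id
  -- `S'` is fixed before the remaining columns are known; they then pick `σ'` from it, and `σ` is
  -- chosen last.
  step : ∀ S ∈ F, ∀ m, IsPairing m → ∃ S' ∈ F, ∀ σ' ∈ S', ∃ σ ∈ S, ColumnStep E m σ σ'

/-- A pair leaving the first column allows that column to be finished and the rest to be solved with
no virtual pairs. Without such a pair the column is passed by `step`. -/
theorem IsClosedFamily.solves_attachRel [Finite Q] [Finite W] {E : Q → Q → Prop}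
    {F : Set (Set (Q → Q))} (hF : IsClosedFamily E F) {R : W → W → Prop} {c : Q → W}
    (hc : Function.Injective c) (hW : Even (Nat.card W)) (h : Solves F R c) :
    Solves F (attachRel E R c) Sum.inl := by
  intro S hS m hm
  by_cases hcross : ∃ a b, m (.inl a) = .inr b
  · obtain ⟨a, b, hab⟩ := hcross
    obtain ⟨n, n', ⟨σ, hσ, hn⟩, ⟨hn', hR⟩, hj⟩ := exists_joins_sum_map
      (P := fun n => ∃ σ ∈ S, Extends E id σ n)
      (fun m hm => by
        obtain ⟨σ, hσ, n, hn, hj⟩ := hF.finish S hS m hm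
        exact ⟨n, ⟨σ, hσ, hn⟩, hj⟩)
      (fun n ⟨σ, _, hn⟩ => hn.1) (h.pairJoin hF.id_mem) hW hm hab
    exact ⟨σ, hσ, _, hn.sumMap hn' hR, hj⟩
  push Not at hcross
  obtain ⟨m₀, m₁, hm₀, hm₁, rfl⟩ := hm.exists_eq_sumMap hcross
  obtain ⟨S', hS', hstep⟩ := hF.step S hS m₀ hm₀
  obtain ⟨σ', hσ', n', hn', hj⟩ := h S' hS' m₁ hm₁
  obtain ⟨σ, hσ, hs⟩ := hstep σ' hσ'
  exact ⟨σ, hσ, hs.exists_extends hF.irrefl hc hn' hj⟩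

/-- The Cartesian product of a path and a relation. -/
def stripRel (E : Q → Q → Prop) (n : ℕ) (x y : Fin n × Q) : Prop :=
  (x.1 = y.1 ∧ E x.2 y.2) ∨ (x.2 = y.2 ∧ (x.1.val + 1 = y.1.val ∨ y.1.val + 1 = x.1.val))

theorem IsClosedFamily.solves_stripRel [Finite Q] (hQ : Even (Nat.card Q)) {E : Q → Q → Prop}
    {F : Set (Set (Q → Q))} (hF : IsClosedFamily E F) (n : ℕ) :
    Solves F (stripRel E (n + 1)) fun a => ((0 : Fin (n + 1)), a) := by
  induction n with
  | zero =>
    refine hF.finish.map (Equiv.uniqueProd Q (Fin 1)).symm (fun x y h => .inl ⟨rfl, h⟩)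
      fun a => rfl
  | succ n ih =>
    let f : Q ⊕ (Fin (n + 1) × Q) → Fin (n + 2) × Q :=
      Sum.elim (fun a => (0, a)) fun p => (p.1.succ, p.2)
    have hf : Function.Bijective f := by
      constructor
      · rintro (a | ⟨i, a⟩) (b | ⟨j, b⟩) h
        · simpa [f] using h
        · exact ((Fin.succ_ne_zero j).symm (congrArg Prod.fst h)).elim
        · exact (Fin.succ_ne_zero i (congrArg Prod.fst h)).elim
        · simpa [f] using h
      · rintro ⟨i, a⟩
        induction i using Fin.cases with
        | zero => exact ⟨.inl a, rfl⟩
        | succ i => exact ⟨.inr (i, a), rfl⟩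
    refine (hF.solves_attachRel (fun a b h => congrArg Prod.snd h) ?_ ih).map
      (Equiv.ofBijective f hf) ?_ fun a => rfl
    · rw [Nat.card_prod]
      exact hQ.mul_left _
    · rintro (a | ⟨i, a⟩) (b | ⟨j, b⟩) h
      · exact .inl ⟨rfl, h⟩
      · obtain ⟨rfl, rfl⟩ := Prod.mk.inj h
        exact .inr ⟨rfl, .inl rfl⟩
      · obtain ⟨rfl, rfl⟩ := Prod.mk.inj h
        exact .inr ⟨rfl, .inr rfl⟩
      · rcases h with ⟨h, h'⟩ | ⟨h, h'⟩
        · exact .inl ⟨congrArg Fin.succ h, h'⟩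
        · exact .inr ⟨h, by simpa [f] using h'⟩

end Strip

/-! ### The finite computation on the cube -/

section Cube

/-- The digit of index `x` in base eight. Maps from `Fin 8` to itself are encoded by having their
values as base eight digits. -/
def digit (c x : ℕ) : ℕ := Nat.land (Nat.shiftRight c (Nat.mul 3 x)) 7

/-- The automorphisms of the cube graph, encoded in base eight. -/
def cubeAutCodes : List ℕ :=
  [16434824, 14570689, 11788826, 9924691, 6852524, 4988389, 2206526, 342391, 16362248, 14498113,
   11571098, 9706963, 7070252, 5206117, 2279102, 414967, 16205392, 13882393, 12477122, 10154123,
   6623092, 4300093, 2894822, 571823, 16096528, 13700953, 12368258, 9972683, 6804532, 4408957,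
   3076262, 680687, 15673952, 13350953, 10882802, 8559803, 8217412, 5894413, 3426262, 1103263,
   15637664, 13242089, 10991666, 8596091, 8181124, 5785549, 3535126, 1139551]

/-- Families of partial pairings of the cube, each encoded as an involution in base eight.
Each family comes with an entry for every pairing of the cube (in the order of `pairingCodes`): the
index of the next family multiplied by `48`, plus the index of an automorphism to apply to it. -/
def families : List (List ℕ × List ℕ) :=
  [([16434824],
    [96, 144, 144, 160, 50, 50, 146, 50, 50, 51, 51, 152, 50, 50, 152, 148, 112, 148, 49, 144, 49,
     51, 51, 168, 144, 49, 49, 49, 168, 49, 148, 144, 48, 48, 48, 48, 48, 153, 48, 48, 48, 48, 48,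
     48, 48, 49, 49, 152, 50, 169, 50, 154, 128, 154, 49, 152, 49, 49, 49, 169, 48, 48, 48, 48,
     48, 145, 154, 152, 48, 48, 48, 48, 48, 48, 48, 48, 48, 48, 169, 48, 48, 48, 48, 48, 48, 168,
     48, 162, 48, 48, 48, 48, 48, 48, 145, 48, 48, 48, 48, 48, 48, 153, 144, 48, 48]),
   ([16434817, 16434698, 16418444],
    [100, 145, 145, 167, 51, 53, 147, 51, 53, 51, 51, 153, 51, 51, 153, 151, 116, 151, 51, 151,
     53, 51, 51, 170, 151, 51, 54, 51, 170, 51, 151, 145, 51, 51, 51, 51, 51, 153, 51, 51, 51, 51,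
     51, 51, 51, 51, 51, 159, 53, 175, 53, 159, 130, 159, 54, 159, 51, 53, 51, 175, 51, 51, 53,
     53, 53, 145, 159, 153, 51, 53, 53, 51, 53, 51, 51, 51, 51, 54, 175, 53, 54, 54, 53, 51, 54,
     170, 51, 162, 51, 51, 51, 51, 51, 53, 145, 55, 53, 51, 51, 55, 51, 153, 145, 51, 51]),
   ([16433816, 8048264, 1754319, 12306056, 14501704],
    [98, 144, 144, 160, 52, 52, 146, 52, 188, 188, 52, 241, 52, 53, 194, 148, 168, 52, 49, 49,
     144, 52, 52, 192, 144, 49, 185, 49, 168, 49, 148, 49, 48, 48, 154, 48, 48, 48, 48, 48, 48,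
     48, 48, 53, 48, 49, 54, 49, 50, 204, 50, 154, 185, 154, 54, 240, 49, 49, 49, 184, 48, 48,
     148, 48, 154, 148, 154, 48, 48, 48, 48, 48, 48, 48, 52, 52, 48, 48, 168, 48, 48, 48, 52, 48,
     48, 48, 48, 164, 48, 48, 48, 48, 48, 48, 148, 185, 48, 48, 48, 48, 48, 154, 144, 48, 48]),
   ([16336712, 16406026, 15386504, 15918602],
    [147, 147, 55, 160, 160, 288, 147, 55, 288, 147, 55, 288, 55, 55, 55, 302, 168, 52, 49, 49,
     155, 155, 55, 201, 49, 49, 155, 49, 168, 49, 49, 49, 49, 49, 49, 49, 52, 55, 55, 49, 49, 49,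
     55, 55, 55, 49, 49, 155, 298, 336, 147, 155, 350, 55, 49, 155, 49, 49, 49, 345, 49, 49, 155,
     52, 147, 147, 49, 155, 49, 49, 155, 49, 49, 49, 49, 49, 49, 155, 168, 147, 147, 49, 155, 49,
     52, 201, 52, 49, 52, 49, 49, 49, 49, 147, 147, 147, 49, 49, 49, 55, 52, 55, 49, 49, 49]),
   ([16433816, 16418444, 16431240, 15918280],
    [146, 166, 55, 166, 50, 50, 149, 50, 50, 309, 53, 183, 50, 50, 54, 149, 174, 55, 49, 149, 49,
     294, 144, 198, 149, 49, 49, 49, 170, 49, 49, 50, 48, 149, 309, 50, 48, 154, 48, 149, 48, 48,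
     48, 48, 154, 183, 191, 53, 344, 342, 354, 329, 191, 54, 191, 54, 53, 54, 54, 53, 48, 50, 48,
     166, 174, 50, 48, 53, 48, 53, 48, 48, 53, 50, 53, 50, 48, 48, 174, 55, 55, 149, 48, 48, 48,
     189, 48, 48, 50, 48, 48, 48, 50, 50, 55, 174, 48, 48, 154, 157, 52, 183, 54, 48, 48]),
   ([16303784, 1754767, 12306056, 14571144],
    [150, 225, 52, 50, 50, 50, 50, 50, 50, 51, 51, 152, 50, 50, 50, 148, 170, 54, 49, 49, 52, 187,
     52, 185, 49, 49, 54, 49, 170, 49, 50, 51, 50, 48, 48, 48, 48, 158, 48, 48, 48, 48, 48, 48,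
     48, 50, 49, 49, 187, 186, 152, 333, 179, 50, 158, 49, 49, 179, 49, 49, 48, 48, 48, 48, 48,
     148, 52, 49, 48, 152, 48, 48, 178, 48, 48, 48, 48, 48, 170, 48, 48, 52, 48, 48, 52, 50, 48,
     162, 48, 48, 48, 48, 48, 48, 148, 48, 150, 48, 48, 333, 48, 187, 150, 48, 48]),
   ([12306056, 7917224, 14599816, 6737584],
    [144, 144, 52, 52, 50, 50, 52, 50, 50, 52, 52, 152, 50, 50, 152, 148, 164, 144, 144, 144, 49,
     144, 52, 168, 144, 49, 49, 52, 185, 49, 144, 50, 50, 48, 48, 48, 48, 224, 48, 48, 48, 48, 48,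
     48, 48, 234, 152, 152, 293, 311, 152, 291, 133, 234, 291, 152, 152, 291, 152, 225, 48, 48,
     48, 48, 48, 48, 52, 152, 48, 52, 48, 48, 178, 48, 48, 48, 48, 48, 48, 48, 48, 52, 48, 48, 52,
     168, 48, 178, 48, 48, 48, 48, 48, 48, 48, 48, 52, 48, 48, 144, 48, 179, 144, 48, 48]),
   ([16434817, 15124144, 8048264, 1753759, 14598808],
    [152, 144, 52, 50, 52, 346, 50, 50, 349, 158, 52, 339, 50, 251, 158, 150, 163, 53, 52, 144,
     52, 163, 52, 198, 144, 52, 180, 52, 55, 180, 50, 48, 48, 48, 154, 48, 50, 52, 48, 48, 50,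
     144, 50, 50, 181, 50, 50, 50, 50, 188, 50, 214, 180, 50, 158, 321, 50, 162, 50, 55, 48, 48,
     50, 48, 53, 48, 152, 52, 50, 48, 54, 48, 48, 48, 52, 50, 50, 180, 50, 48, 50, 48, 50, 48,
     162, 50, 48, 164, 48, 48, 48, 48, 50, 50, 50, 152, 48, 48, 52, 163, 48, 55, 144, 48, 50])]

def cubeVertices : List ℕ := [0, 1, 2, 3, 4, 5, 6, 7]

/-- The adjacency of the cube graph, whose vertices are the three-digit binary numbers. -/
def cubeAdj (a b : ℕ) : Bool :=
  Nat.beq (Nat.xor a b) 1 || Nat.beq (Nat.xor a b) 2 || Nat.beq (Nat.xor a b) 4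

def isFixed (c x : ℕ) : Bool := Nat.beq (digit c x) x

/-- The encoding of the map `f` on the list `l`. -/
def encode (f : ℕ → ℕ) (l : List ℕ) : ℕ := (l.map fun x => Nat.mul (f x) (Nat.pow 8 x)).sum

/-- Adds the pair `{a, b}` to an encoding. -/
def addPair (c a b : ℕ) : ℕ :=
  Nat.add c (Nat.add (Nat.mul b (Nat.pow 8 a)) (Nat.mul a (Nat.pow 8 b)))

/-- All encodings obtained from `c` by adding pairs that cover the list `l`. -/
def pairingCodes : ℕ → List ℕ → ℕ → List ℕ
  | _, [], c => [c]
  | 0, _ :: _, _ => []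
  | k + 1, a :: l, c => l.flatMap fun b => pairingCodes k (l.erase b) (addPair c a b)

/-- Whether some encoding obtained from `c` by adding edges of the cube that cover the list `l`
satisfies `p`. -/
def anyMatching (p : ℕ → Bool) : ℕ → List ℕ → ℕ → Bool
  | _, [], c => p c
  | 0, _ :: _, _ => false
  | k + 1, a :: l, c => l.any fun b => cubeAdj a b && anyMatching p k (l.erase b) (addPair c a b)

/-- Whether `y` is among the first `2 * k` vertices of the walk from `x` that applies `m` and `n`
alternately. -/
def onWalk (m n y : ℕ) : ℕ → ℕ → Bool
  | 0, _ => false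
  | k + 1, x => Nat.beq y x || (Nat.beq y (digit m x) || onWalk m n y k (digit n (digit m x)))

/-- Whether `n` is an involution that fixes what `s'` moves, extends `s` and otherwise consists of
edges of the cube. -/
def isStepMatching (s s' n : ℕ) : Bool :=
  cubeVertices.all fun x => cond (isFixed s' x)
    (Nat.beq (digit n (digit n x)) x &&
      cond (isFixed s x) (cubeAdj x (digit n x)) (Nat.beq (digit n x) (digit s x)))
    (isFixed n x && isFixed s x)

/-- Whether the alternating walks from the vertices moved by `s'` cover the cube and link these
vertices in the same way as `s'`. -/
def isStepLinked (m n s' : ℕ) : Bool :=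
  ((cubeVertices.filter fun a => !isFixed s' a).all fun a => onWalk m n (digit s' a) 4 a) &&
    cubeVertices.all fun x =>
      (cubeVertices.filter fun a => !isFixed s' a).any fun a => onWalk m n x 4 a

/-- Whether some extension of `s` by edges of the cube outside `s'` satisfies `p`. -/
def anyExtension (s s' : ℕ) (p : ℕ → Bool) : Bool :=
  anyMatching p 4 (cubeVertices.filter fun x => isFixed s x && isFixed s' x)
    -- Vertices still to be matched start with digit 0, since `addPair` only adds.
    (encode (fun x => cond (isFixed s x) (cond (isFixed s' x) 0 x) (digit s x)) cubeVertices)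

/-- Whether `s'` is the conjugate of `s` by `h`. -/
def isConj (h s s' : ℕ) : Bool :=
  cubeVertices.all fun x => Nat.beq (digit s' (digit h x)) (digit h (digit s x))

/-- Only a candidate for the conjugate: `checkStep` tests it with `isConj`. -/
def conjCode (h s : ℕ) : ℕ :=
  (cubeVertices.map fun x => Nat.mul (digit h (digit s x)) (Nat.pow 8 (digit h x))).sum

/-- The code of the identity. -/
def idCode : ℕ := 16434824

/-- The finite form of `IsClosedFamily.step`, with `S'` transported by `h`. The test that `s` and
the conjugate move no common vertex only prunes the search, as `isStepMatching` implies it. -/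
def checkStep (m h : ℕ) (S S' : List ℕ) : Bool :=
  S'.all fun s₀ => isConj h s₀ (conjCode h s₀) && S.any fun s =>
    cubeVertices.all (fun x => isFixed s x || isFixed (conjCode h s₀) x) &&
      anyExtension s (conjCode h s₀) fun n =>
        isStepLinked m n (conjCode h s₀) && isStepMatching s (conjCode h s₀) n

def checkFinish (m : ℕ) (S : List ℕ) : Bool :=
  S.any fun s => anyExtension s idCode fun n =>
    cubeVertices.all (fun x => onWalk m n x 4 0) && isStepMatching s idCode n

def checkFamily (S : List ℕ) : List ℕ → List ℕ → Bool
  | [], _ => true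
  | _ :: _, [] => false
  | m :: ms, q :: qs => checkFinish m S &&
      (match cubeAutCodes[Nat.mod q 48]?, families[Nat.div q 48]? with
        | some h, some p => checkStep m h S p.1
        | _, _ => false) && checkFamily S ms qs

theorem checkFamily_eq_true :
    ∀ p ∈ families, checkFamily p.1 (pairingCodes 4 cubeVertices 0) p.2 = true := by
  rw [← List.all_eq_true]
  decide +kernel

end Cube

/-! ### Invariance under automorphisms of a column -/

section Transport

variable {Q : Type*} {E : Q → Q → Prop} {e : Equiv.Perm Q}

theorem Extends.conj (he : ∀ x y, E (e x) (e y) ↔ E x y) {σ n : Q → Q} (h : Extends E id σ n) :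
    Extends E id (e ∘ σ ∘ e.symm) (e ∘ n ∘ e.symm) := by
  obtain ⟨hn, hσ, hE⟩ := h
  refine ⟨hn.conj e, fun a ha => ?_, fun x hx => ?_⟩
  · have := hσ (e.symm a) fun h => ha (by simp [h])
    exact congrArg e this
  · rw [← e.apply_symm_apply x]
    simp only [Function.comp_apply, Equiv.symm_apply_apply, he]
    exact hE _ fun a ha h => hx (e a) (by simpa using ha) (by rw [← e.apply_symm_apply x, h]; rfl)

theorem ColumnStep.conj (he : ∀ x y, E (e x) (e y) ↔ E x y) {m σ σ' : Q → Q}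
    (h : ColumnStep E m σ σ') :
    ColumnStep E (e ∘ m ∘ e.symm) (e ∘ σ ∘ e.symm) (e ∘ σ' ∘ e.symm) := by
  obtain ⟨hσ', n, hn, h₁, h₂, h₃, h₄⟩ := h
  have hfix : ∀ (f : Q → Q) x, (e ∘ f ∘ e.symm) x = x ↔ f (e.symm x) = e.symm x := fun f x => by
    simp [Equiv.eq_symm_apply]
  refine ⟨fun x => by simp [hσ' _], e ∘ n ∘ e.symm, fun x => by simp [hn _], fun x => ?_,
    fun x => ?_, fun x => ?_, fun t htm htn => ?_⟩
  · rw [Ne, hfix, hfix, hfix]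
    exact h₁ _
  · rw [Ne, hfix, hfix]
    exact fun h h' => congrArg e (h₂ _ h h')
  · rw [hfix, hfix]
    intro h h'
    have := h₃ _ h h'
    rw [← he] at this
    simpa using this
  · obtain ⟨h₅, h₆⟩ := h₄ (t.comap e) (fun x => by simpa [Setoid.comap_rel] using htm (e x))
      (fun x => by simpa [Setoid.comap_rel] using htn (e x))
    refine ⟨fun x => by simpa [Setoid.comap_rel] using h₅ (e.symm x), fun x => ?_⟩
    obtain ⟨a, ha, hxa⟩ := h₆ (e.symm x)
    exact ⟨e a, by simpa using ha, by simpa [Setoid.comap_rel] using hxa⟩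

end Transport

/-! ### From codes to maps -/

section Decode

theorem digit_lt (c x : ℕ) : digit c x < 8 :=
  Nat.lt_succ_of_le Nat.and_le_right

/-- The map with a given code. -/
def decode (c : ℕ) (x : Fin 8) : Fin 8 := ⟨digit c x, digit_lt c x⟩

theorem coe_decode (c : ℕ) (x : Fin 8) : (decode c x : ℕ) = digit c x := rfl

/-- The adjacency relation of the cube graph. -/
def CubeRel (x y : Fin 8) : Prop := cubeAdj x y = true

theorem all_cubeVertices {p : ℕ → Bool} :
    cubeVertices.all p = true ↔ ∀ x : Fin 8, p x = true := by
  simp [cubeVertices, Fin.forall_fin_succ]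

theorem isFixed_iff {c : ℕ} {x : Fin 8} : isFixed c x = true ↔ decode c x = x := by
  simp [isFixed, decode, Fin.ext_iff]

theorem decode_idCode : decode idCode = id := by
  decide +kernel

theorem rel_of_onWalk {m n : ℕ} {t : Setoid (Fin 8)} (hm : ∀ x, t x (decode m x))
    (hn : ∀ x, t x (decode n x)) {y : Fin 8} :
    ∀ (k : ℕ) (x : Fin 8), onWalk m n y k x = true → t x y
  | 0, _, h => by simp [onWalk] at h
  | k + 1, x, h => by
    simp only [onWalk, Bool.or_eq_true, Nat.beq_eq] at h
    rcases h with h | h | h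
    · rw [Fin.ext h]
    · have : y = decode m x := Fin.ext h
      rw [this]
      exact hm x
    · exact t.trans (hm x) (t.trans (hn _) (rel_of_onWalk hm hn k (decode n (decode m x)) h))

theorem encode_nil (f : ℕ → ℕ) : encode f [] = 0 := rfl

theorem encode_cons (f : ℕ → ℕ) (a : ℕ) (l : List ℕ) :
    encode f (a :: l) = f a * 8 ^ a + encode f l := rfl

/-- All values are below 8, so no carries occur. -/
theorem digit_encode {f : ℕ → ℕ} (hf : ∀ x, x < 8 → f x < 8) (x : Fin 8) :
    digit (encode f cubeVertices) x = f x := by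
  have h : ∀ c y, digit c y = c / 8 ^ y % 8 := fun c y => by
    have h8 : (8 : ℕ) ^ y = 2 ^ (3 * y) := by rw [pow_mul]; norm_num
    rw [h8, ← Nat.shiftRight_eq_div_pow]
    exact Nat.and_two_pow_sub_one_eq_mod (c >>> (3 * y)) 3
  have h0 := hf 0
  have h1 := hf 1
  have h2 := hf 2
  have h3 := hf 3
  have h4 := hf 4
  have h5 := hf 5
  have h6 := hf 6
  have h7 := hf 7
  have henc : encode f cubeVertices = f 0 + f 1 * 8 + f 2 * 64 + f 3 * 512 + f 4 * 4096 +
      f 5 * 32768 + f 6 * 262144 + f 7 * 2097152 := by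
    rw [cubeVertices, encode_cons, encode_cons, encode_cons, encode_cons, encode_cons,
      encode_cons, encode_cons, encode_cons, encode_nil]
    ring
  rw [h, henc]
  fin_cases x <;> simp only [pow_zero, pow_one, Nat.reducePow, Nat.div_one] <;> omega

/-- Completeness of the enumeration: the first vertex of `l` is paired with its partner, and both
leave the list. -/
theorem encode_mem_pairingCodes {f : ℕ → ℕ} (hf : Function.Involutive f) :
    ∀ (k : ℕ) (l : List ℕ) (c : ℕ), l.Nodup → (∀ x ∈ l, f x ∈ l ∧ f x ≠ x) → l.length ≤ 2 * k →
      c + encode f l ∈ pairingCodes k l c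
  | k, [], c, _, _, _ => by cases k <;> simp [pairingCodes, encode]
  | 0, _ :: _, _, _, _, h => by simp at h
  | k + 1, a :: l, c, hl, hmem, hlen => by
    obtain ⟨ha, hl⟩ := List.nodup_cons.1 hl
    have hb : f a ∈ l := by
      have := hmem a List.mem_cons_self
      exact (List.mem_cons.1 this.1).resolve_left this.2
    refine List.mem_flatMap.2 ⟨f a, hb, ?_⟩
    have ih := encode_mem_pairingCodes hf k (l.erase (f a)) (addPair c a (f a)) (hl.erase _)
      (fun x hx => ?_) (by
        rw [List.length_erase_of_mem hb]
        simp only [List.length_cons] at hlen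
        omega)
    · have hsum : encode f l = f (f a) * 8 ^ f a + encode f (l.erase (f a)) :=
        ((List.perm_cons_erase hb).map _).sum_eq
      rw [hf] at hsum
      have hadd : addPair c a (f a) = c + (f a * 8 ^ a + a * 8 ^ f a) := rfl
      convert ih using 1
      rw [encode_cons, hsum, hadd]
      ring
    · rw [hl.mem_erase_iff] at hx ⊢
      obtain ⟨hxa, hx⟩ := hx
      have := hmem x (List.mem_cons_of_mem _ hx)
      refine ⟨⟨fun h => ha (hf.injective h ▸ hx), ?_⟩, this.2⟩
      exact (List.mem_cons.1 this.1).resolve_left fun h => hxa (by rw [← h, hf])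

theorem exists_mem_pairingCodes {m : Fin 8 → Fin 8} (hm : IsPairing m) :
    ∃ c ∈ pairingCodes 4 cubeVertices 0, decode c = m := by
  let f : ℕ → ℕ := fun x => if h : x < 8 then m ⟨x, h⟩ else x
  have hfm : ∀ x : Fin 8, f x = m x := fun x => dif_pos x.2
  have hmem : ∀ x, x ∈ cubeVertices ↔ x < 8 := fun x => by
    rw [show cubeVertices = List.range 8 from rfl, List.mem_range]
  have hf : Function.Involutive f := fun x => by
    by_cases h : x < 8
    · rw [hfm ⟨x, h⟩, hfm, hm.involutive]
    · have : f x = x := dif_neg h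
      rw [this, this]
  refine ⟨encode f cubeVertices, ?_, ?_⟩
  · have := encode_mem_pairingCodes hf 4 cubeVertices 0 (by decide) (fun x hx => ?_) (by decide)
    · rwa [zero_add] at this
    · rw [hmem] at hx ⊢
      rw [hfm ⟨x, hx⟩]
      exact ⟨Fin.is_lt _, fun h => hm.ne ⟨x, hx⟩ (Fin.ext h)⟩
  · funext x
    refine Fin.ext ?_
    rw [coe_decode, digit_encode fun x hx => (hfm ⟨x, hx⟩).symm ▸ Fin.is_lt _, hfm]

/-- Bare existence is enough, because the predicates searched for include `isStepMatching`, which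
tests the result from scratch. -/
theorem exists_of_anyMatching {p : ℕ → Bool} : ∀ (k : ℕ) (l : List ℕ) (c : ℕ),
    anyMatching p k l c = true → ∃ n, p n = true
  | k, [], c, h => ⟨c, by cases k <;> exact h⟩
  | 0, _ :: _, _, h => by simp [anyMatching] at h
  | k + 1, a :: l, c, h => by
    simp only [anyMatching, List.any_eq_true, Bool.and_eq_true] at h
    obtain ⟨b, -, -, h⟩ := h
    exact exists_of_anyMatching k _ _ h

theorem isStepMatching_iff {s s' n : ℕ} : isStepMatching s s' n = true ↔
    ∀ x, (decode s' x ≠ x → decode n x = x ∧ decode s x = x) ∧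
      (decode s' x = x → decode n (decode n x) = x ∧
        (decode s x ≠ x → decode n x = decode s x) ∧
        (decode s x = x → CubeRel x (decode n x))) := by
  rw [isStepMatching, all_cubeVertices]
  refine forall_congr' fun x => ?_
  have hf : ∀ c, (isFixed c x = true) = (decode c x = x) := fun c => propext isFixed_iff
  have hd : ∀ c d, (digit c x = digit d x) = (decode c x = decode d x) := fun c d => by
    simp [decode]
  have hdd : (digit n (digit n x) = x) = (decode n (decode n x) = x) := by
    simp [decode, Fin.ext_iff]
  have hE : (cubeAdj x (digit n x) = true) = CubeRel x (decode n x) := rfl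
  simp only [Bool.cond_eq_ite, hf]
  by_cases h' : decode s' x = x <;> by_cases h : decode s x = x <;>
    simp [h, h', hf, hd, hdd, hE]

end Decode

/-! ### The closed family of the cube -/

section CubeFamily

theorem extends_of_isStepMatching {s n : ℕ} (h : isStepMatching s idCode n = true) :
    Extends CubeRel id (decode s) (decode n) := by
  rw [isStepMatching_iff, decode_idCode] at h
  have h := fun x => (h x).2 rfl
  refine ⟨⟨fun x => (h x).1, fun x hx => ?_⟩, fun a ha => (h a).2.1 ha, fun x hx => (h x).2.2 ?_⟩
  · by_cases hs : decode s x = x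
    · have := (h x).2.2 hs
      rw [hx] at this
      simp [CubeRel, cubeAdj] at this
    · exact hs (by rw [← (h x).2.1 hs, hx])
  · by_contra hs
    exact hx x hs rfl

theorem exists_of_checkFinish {m : ℕ} {S : List ℕ} (h : checkFinish m S = true) :
    ∃ s ∈ S, ∃ n, Extends CubeRel id (decode s) n ∧ Joins (decode m) n := by
  simp only [checkFinish, List.any_eq_true] at h
  obtain ⟨s, hs, h⟩ := h
  obtain ⟨n, hn⟩ := exists_of_anyMatching _ _ _ h
  rw [Bool.and_eq_true, all_cubeVertices] at hn
  refine ⟨s, hs, decode n, extends_of_isStepMatching hn.2, fun t htm htn x y => ?_⟩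
  have h0 : ∀ x, t 0 x := fun x => rel_of_onWalk htm htn 4 0 (hn.1 x)
  exact t.trans (t.symm (h0 x)) (h0 y)

theorem columnStep_of_isStepMatching {m s s' n : ℕ} (hs' : Function.Involutive (decode s'))
    (h : isStepMatching s s' n = true) (hl : isStepLinked m n s' = true) :
    ColumnStep CubeRel (decode m) (decode s) (decode s') := by
  rw [isStepMatching_iff] at h
  refine ⟨hs', decode n, fun x => ?_, fun x => (h x).1, fun x hx => ((h x).2 hx).2.1,
    fun x hx => ((h x).2 hx).2.2, fun t htm htn => ?_⟩
  · by_cases hx : decode s' x = x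
    · exact ((h x).2 hx).1
    · rw [((h x).1 hx).1, ((h x).1 hx).1]
  have hmem : ∀ x : Fin 8, (x : ℕ) ∈ cubeVertices := fun x => by
    rw [show cubeVertices = List.range 8 from rfl, List.mem_range]
    exact x.2
  have hmem' : ∀ x ∈ cubeVertices, x < 8 := fun x hx => by
    rwa [show cubeVertices = List.range 8 from rfl, List.mem_range] at hx
  rw [isStepLinked, Bool.and_eq_true, all_cubeVertices] at hl
  obtain ⟨h₁, h₂⟩ := hl
  refine ⟨fun x => ?_, fun x => ?_⟩
  · by_cases hx : decode s' x = x
    · rw [hx]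
    · refine rel_of_onWalk htm htn 4 x (List.all_eq_true.1 h₁ _ (List.mem_filter.2 ⟨hmem x, ?_⟩))
      rwa [Bool.not_eq_true', ← Bool.not_eq_true, isFixed_iff]
  · obtain ⟨a, ha, hax⟩ := List.any_eq_true.1 (h₂ x)
    obtain ⟨ha8, ha⟩ := List.mem_filter.1 ha
    refine ⟨⟨a, hmem' a ha8⟩, ?_, t.symm (rel_of_onWalk htm htn 4 ⟨a, hmem' a ha8⟩ hax)⟩
    rwa [Ne, ← isFixed_iff, Bool.not_eq_true, ← Bool.not_eq_true']

theorem exists_perm_of_mem_cubeAutCodes {h : ℕ} (hh : h ∈ cubeAutCodes) :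
    ∃ e : Equiv.Perm (Fin 8), ⇑e = decode h ∧ ∀ x y, CubeRel (e x) (e y) ↔ CubeRel x y := by
  have key : ∀ h ∈ cubeAutCodes, ∀ x y : Fin 8, (decode h x = decode h y → x = y) ∧
      cubeAdj (decode h x) (decode h y) = cubeAdj x y := by
    decide +kernel
  have hinj : Function.Injective (decode h) := fun x y => (key h hh x y).1
  exact ⟨Equiv.ofBijective _ (Finite.injective_iff_bijective.1 hinj), rfl,
    fun x y => by simpa [CubeRel] using congrArg (· = true) (key h hh x y).2⟩

theorem involutive_decode_of_mem_families {p : List ℕ × List ℕ} (hp : p ∈ families) {s : ℕ}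
    (hs : s ∈ p.1) : Function.Involutive (decode s) := by
  have key : ∀ p ∈ families, ∀ s ∈ p.1, ∀ x : Fin 8, decode s (decode s x) = x := by
    decide +kernel
  exact key p hp s hs

theorem exists_columnStep_of_checkStep {m h : ℕ} {S S' : List ℕ} {e : Equiv.Perm (Fin 8)}
    (he : ⇑e = decode h) (hS' : ∀ s ∈ S', Function.Involutive (decode s))
    (hc : checkStep m h S S' = true) {s' : ℕ} (hs' : s' ∈ S') :
    ∃ s ∈ S, ColumnStep CubeRel (decode m) (decode s) (e ∘ decode s' ∘ e.symm) := by
  simp only [checkStep, List.all_eq_true, Bool.and_eq_true] at hc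
  obtain ⟨hconj, hc⟩ := hc s' hs'
  obtain ⟨s, hs, hc⟩ := List.any_eq_true.1 hc
  obtain ⟨n, hn⟩ := exists_of_anyMatching _ _ _ (Bool.and_eq_true_iff.1 hc).2
  obtain ⟨hl, hn⟩ := Bool.and_eq_true_iff.1 hn
  have heq : decode (conjCode h s') = e ∘ decode s' ∘ e.symm := by
    rw [isConj, all_cubeVertices] at hconj
    funext x
    have := Fin.ext (a := decode (conjCode h s') (decode h (e.symm x)))
      (b := decode h (decode s' (e.symm x))) (Nat.beq_eq ▸ hconj (e.symm x))
    rwa [← he, e.apply_symm_apply] at this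
  rw [← heq]
  refine ⟨s, hs, columnStep_of_isStepMatching ?_ hn hl⟩
  rw [heq]
  intro x
  simp [hS' s' hs' _]

theorem exists_of_checkFamily {S : List ℕ} : ∀ {ms qs : List ℕ}, checkFamily S ms qs = true →
    ∀ m ∈ ms, checkFinish m S = true ∧
      ∃ h ∈ cubeAutCodes, ∃ p ∈ families, checkStep m h S p.1 = true
  | [], _, _, _, hm => by simp at hm
  | _ :: _, [], h, _, _ => by simp [checkFamily] at h
  | m :: ms, q :: qs, h, m', hm => by
    simp only [checkFamily, Bool.and_eq_true] at h
    obtain ⟨⟨h₁, h₂⟩, h₃⟩ := h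
    rcases List.mem_cons.1 hm with rfl | hm
    · refine ⟨h₁, ?_⟩
      split at h₂
      · next a p ha hp =>
        exact ⟨a, List.mem_of_getElem? ha, p, List.mem_of_getElem? hp, h₂⟩
      · simp at h₂
    · exact exists_of_checkFamily h₃ m' hm

/-- The families of partial pairings of the cube, up to automorphisms of the cube. -/
def cubeFamily : Set (Set (Fin 8 → Fin 8)) :=
  {S | ∃ p ∈ families, ∃ e : Equiv.Perm (Fin 8), (∀ x y, CubeRel (e x) (e y) ↔ CubeRel x y) ∧
    S = {σ | ∃ s ∈ p.1, σ = e ∘ decode s ∘ e.symm}}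

theorem isClosedFamily_cubeFamily : IsClosedFamily CubeRel cubeFamily := by
  have hback : ∀ (e : Equiv.Perm (Fin 8)) {m m₀ : Fin 8 → Fin 8}, m₀ = e.symm ∘ m ∘ e →
      m = e ∘ m₀ ∘ e.symm := by
    rintro e m _ rfl
    funext x
    simp
  refine ⟨fun x => by simp [CubeRel, cubeAdj], ?_, ?_, ?_⟩
  · refine ⟨families[0], List.getElem_mem _, Equiv.refl _, fun _ _ => Iff.rfl, ?_⟩
    have : families[0].1 = [idCode] := rfl
    ext σ
    simp [this, decode_idCode]
  · rintro _ ⟨p, hp, e, he, rfl⟩ m hm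
    -- Conjugating `m` back by `e` reduces to the tabulated representative.
    obtain ⟨c, hc, hcm⟩ := exists_mem_pairingCodes (hm.conj e.symm)
    obtain ⟨h, -⟩ := exists_of_checkFamily (checkFamily_eq_true p hp) c hc
    obtain ⟨s, hs, n, hn, hj⟩ := exists_of_checkFinish h
    refine ⟨_, ⟨s, hs, rfl⟩, _, hn.conj he, ?_⟩
    rw [hback e hcm]
    exact hj.conj e
  · rintro _ ⟨p, hp, e, he, rfl⟩ m hm
    obtain ⟨c, hc, hcm⟩ := exists_mem_pairingCodes (hm.conj e.symm)
    obtain ⟨-, h, hh, p', hp', hstep⟩ := exists_of_checkFamily (checkFamily_eq_true p hp) c hc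
    obtain ⟨e', he', hrel⟩ := exists_perm_of_mem_cubeAutCodes hh
    refine ⟨_, ⟨p', hp', e'.trans e, fun x y => ?_, rfl⟩, ?_⟩
    · simp [he, hrel]
    · rintro _ ⟨s', hs', rfl⟩
      obtain ⟨s, hs, hcol⟩ := exists_columnStep_of_checkStep he'
        (fun s hs => involutive_decode_of_mem_families hp' hs) hstep hs'
      refine ⟨_, ⟨s, hs, rfl⟩, ?_⟩
      rw [hback e hcm]
      exact hcol.conj he

end CubeFamily

/-! ### The third prism contains the strip over the cube -/

section Prism

variable {V : Type*}

instance PrismVertex.finite [Finite V] : ∀ k, Finite (PrismVertex V k)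
  | 0 => ‹Finite V›
  | k + 1 => by
    have := PrismVertex.finite k
    exact inferInstanceAs (Finite (PrismVertex V k × Bool))

theorem even_card_prismVertex [Finite V] (k : ℕ) : Even (Nat.card (PrismVertex V (k + 1))) := by
  change Even (Nat.card (PrismVertex V k × Bool))
  rw [Nat.card_prod]
  exact Even.mul_left (by simp) _

theorem SimpleGraph.pairJoin_prism [Finite V] {G : SimpleGraph V} (hV : Even (Nat.card V))
    (h : PairJoin G.Adj) : PairJoin G.prism.Adj := by
  let e : V ⊕ V ≃ V × Bool := (Equiv.boolProdEquivSum V).symm.trans (Equiv.prodComm _ _)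
  refine (h.prism hV).map e ?_
  rintro (a | a) (b | b) hab <;> simp_all [e, SimpleGraph.prism, attachRel]

theorem SimpleGraph.pairJoin_prismPow_add [Finite V] {G : SimpleGraph V} {k : ℕ}
    (h : PairJoin (G.prismPow (k + 1)).Adj) (j : ℕ) : PairJoin (G.prismPow (k + 1 + j)).Adj := by
  induction j with
  | zero => exact h
  | succ j ih =>
    refine SimpleGraph.pairJoin_prism ?_ ih
    have := even_card_prismVertex (V := V) (k + j)
    rwa [Nat.add_right_comm] at this

open scoped Classical in
theorem SimpleGraph.Walk.IsHamiltonian.bijective_getVert {G : SimpleGraph V} {u v : V}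
    {p : G.Walk u v} (hp : p.IsHamiltonian) :
    Function.Bijective fun i : Fin (p.length + 1) => p.getVert i := by
  constructor
  · intro i j hij
    exact Fin.ext (hp.isPath.getVert_injOn (Nat.lt_succ_iff.1 i.2) (Nat.lt_succ_iff.1 j.2) hij)
  · intro x
    obtain ⟨n, hn, hnl⟩ := SimpleGraph.Walk.mem_support_iff_exists_getVert.1 (hp.mem_support x)
    exact ⟨⟨n, Nat.lt_succ_of_le hnl⟩, hn⟩

/-- The identification of the vertices of the cube graph with triples of bits. -/
theorem bijective_testBit : Function.Bijective fun a : Fin 8 =>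
    (((a : ℕ).testBit 0, (a : ℕ).testBit 1), (a : ℕ).testBit 2) := by
  decide

theorem testBit_of_cubeRel {a b : Fin 8} (h : CubeRel a b) : ∃ i < 3,
    (a : ℕ).testBit i ≠ (b : ℕ).testBit i ∧
      ∀ j < 3, j ≠ i → (a : ℕ).testBit j = (b : ℕ).testBit j := by
  unfold CubeRel at h
  revert a b
  decide

theorem SimpleGraph.IsTraceable.pairJoin_prism_prism_prism {G : SimpleGraph V}
    (hG : G.IsTraceable) : PairJoin G.prism.prism.prism.Adj := by
  obtain ⟨u, v, p, hp⟩ := hG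
  -- Position on the Hamiltonian path gives the column; the three bits of a cube vertex are the
  -- three prism coordinates.
  let f : Fin (p.length + 1) × Fin 8 → ((V × Bool) × Bool) × Bool := fun x =>
    (((p.getVert x.1, (x.2 : ℕ).testBit 0), (x.2 : ℕ).testBit 1), (x.2 : ℕ).testBit 2)
  have hf : Function.Bijective f := by
    constructor
    · rintro ⟨i, a⟩ ⟨j, b⟩ h
      simp only [f, Prod.mk.injEq] at h
      obtain ⟨⟨⟨h, h₀⟩, h₁⟩, h₂⟩ := h
      have h := hp.bijective_getVert.1 h
      have h' := bijective_testBit.1 (Prod.ext (Prod.ext h₀ h₁) h₂ : (((a : ℕ).testBit 0,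
        (a : ℕ).testBit 1), (a : ℕ).testBit 2) = (((b : ℕ).testBit 0,
        (b : ℕ).testBit 1), (b : ℕ).testBit 2))
      rw [h, h']
    · rintro ⟨⟨⟨x, b₀⟩, b₁⟩, b₂⟩
      obtain ⟨i, hi⟩ := hp.bijective_getVert.2 x
      obtain ⟨a, ha⟩ := bijective_testBit.2 ((b₀, b₁), b₂)
      simp only [Prod.mk.injEq] at ha hi
      exact ⟨(i, a), by simp only [f, hi, ha]⟩
  have h := isClosedFamily_cubeFamily.solves_stripRel (by simp; decide) p.length
  refine (h.pairJoin isClosedFamily_cubeFamily.id_mem).map (Equiv.ofBijective f hf) ?_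
  rintro ⟨i, a⟩ ⟨j, b⟩ (⟨hi, hab⟩ | ⟨ha, hij⟩)
  all_goals simp only at *
  · subst hi
    obtain ⟨k, hk, hne, heq⟩ := testBit_of_cubeRel hab
    have h₀ := heq 0
    have h₁ := heq 1
    have h₂ := heq 2
    simp only [Equiv.ofBijective_apply, f, SimpleGraph.prism,
      SimpleGraph.boxProd_adj, SimpleGraph.top_adj]
    interval_cases k <;> simp_all
  · subst ha
    have : G.Adj (p.getVert i) (p.getVert j) := by
      rcases hij with hij | hij
      · rw [← hij]
        exact p.adj_getVert_succ (by omega)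
      · rw [← hij]
        exact (p.adj_getVert_succ (by omega)).symm
    simp [f, SimpleGraph.prism, this]

end Prism

/-! ### From joined pairings to Hamiltonian cycles -/

section Hamiltonian

variable {V : Type*}

/-- The graph whose edges are the pairs of two given pairings. -/
def IsPairing.unionGraph {m n : V → V} (hm : IsPairing m) (hn : IsPairing n) :
    SimpleGraph V where
  Adj v w := m v = w ∨ n v = w
  symm := ⟨by
    rintro v _ (rfl | rfl)
    · exact .inl (hm.involutive v)
    · exact .inr (hn.involutive v)⟩
  loopless := ⟨fun v h => h.elim (hm.ne v) (hn.ne v)⟩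

theorem SimpleGraph.Subgraph.IsPerfectMatching.exists_isPairing {G : SimpleGraph V}
    {M : G.Subgraph} (hM : M.IsPerfectMatching) :
    ∃ m, IsPairing m ∧ ∀ v w, M.Adj v w ↔ m v = w := by
  choose m hm hm' using fun v => hM.1 (hM.2 v)
  have hiff : ∀ v w, M.Adj v w ↔ m v = w := fun v w =>
    ⟨fun h => (hm' v w h).symm, fun h => h ▸ hm v⟩
  exact ⟨m, ⟨fun v => (hiff _ _).1 (hm v).symm, fun v => (M.adj_sub (hm v)).ne'⟩, hiff⟩

theorem IsPairing.exists_isPerfectMatching {G : SimpleGraph V} {n : V → V} (hn : IsPairing n)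
    (hG : ∀ v, G.Adj v (n v)) :
    ∃ N : G.Subgraph, N.IsPerfectMatching ∧ ∀ v w, N.Adj v w ↔ n v = w := by
  let N : G.Subgraph :=
    { verts := Set.univ
      Adj := fun v w => n v = w
      adj_sub := fun {v w} h => h ▸ hG v
      edge_vert := fun _ => Set.mem_univ _
      symm := ⟨fun v w h => h ▸ hn.involutive v⟩ }
  exact ⟨N, ⟨fun v _ => ⟨n v, rfl, fun w h => Eq.symm h⟩, fun v => Set.mem_univ v⟩,
    fun _ _ => Iff.rfl⟩

open scoped Classical in
-- The union is connected and 2-regular, so the cycle through any vertex covers its component, which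
-- is everything.
theorem Joins.exists_isHamiltonianCycle [Finite V] (hV : 3 ≤ Nat.card V) {m n : V → V}
    (hm : IsPairing m) (hn : IsPairing n) (hj : Joins m n) :
    ∃ (v : V) (C : (SimpleGraph.completeGraph V).Walk v v), C.IsHamiltonianCycle ∧
      ∀ x y, s(x, y) ∈ C.edgeSet ↔ m x = y ∨ n x = y := by
  let G := hm.unionGraph hn
  have hreach : ∀ x y, G.Reachable x y := by
    refine hj G.reachableSetoid (fun x => ?_) fun x => ?_
    · exact SimpleGraph.Adj.reachable (G := G) (.inl rfl)
    · exact SimpleGraph.Adj.reachable (G := G) (.inr rfl)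
  -- A common pair would be closed under both maps, hence all of `V`, which has at least three
  -- elements.
  have hmn : ∀ x, m x ≠ n x := by
    intro x hx
    have hset : ∀ y, y ∈ ({x, m x} : Set V) ↔ m y ∈ ({x, m x} : Set V) := fun y => by
      simp only [Set.mem_insert_iff, Set.mem_singleton_iff, hm.involutive.injective.eq_iff,
        hm.involutive.eq_iff]
      tauto
    have hset' : ∀ y, y ∈ ({x, m x} : Set V) ↔ n y ∈ ({x, m x} : Set V) := fun y => by
      simp only [hx, Set.mem_insert_iff, Set.mem_singleton_iff, hn.involutive.injective.eq_iff,
        hn.involutive.eq_iff]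
      tauto
    have huniv : ({x, m x} : Set V) = Set.univ := by
      refine Set.eq_univ_of_forall fun y => ?_
      have := hj (Setoid.ker fun y => y ∈ ({x, m x} : Set V))
        (fun y => propext (hset y)) (fun y => propext (hset' y)) x y
      exact this.mp (Set.mem_insert _ _)
    have := Set.ncard_pair (hm.ne x).symm
    rw [huniv, Set.ncard_univ] at this
    omega
  have hcyc : G.IsCycles := fun x _ => by
    have : G.neighborSet x = {m x, n x} := by
      ext y
      exact or_congr eq_comm eq_comm
    rw [this]
    exact Set.ncard_pair (hmn x)
  have : Nonempty V := (Nat.card_pos_iff.1 (by omega)).1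
  obtain ⟨v⟩ := this
  obtain ⟨p, hp, hverts⟩ :=
    hcyc.exists_cycle_toSubgraph_verts_eq_connectedComponentSupp
      (c := G.connectedComponentMk v) rfl ⟨m v, .inl rfl⟩
  have hmem : ∀ x, x ∈ p.toSubgraph.verts := fun x => by
    rw [hverts]
    exact SimpleGraph.ConnectedComponent.sound (hreach x v)
  have hp' : (p.mapLe (le_top : G ≤ SimpleGraph.completeGraph V)).IsCycle := hp.mapLe _
  refine ⟨v, p.mapLe le_top, ⟨hp', ?_⟩, fun x y => ?_⟩
  · refine hp'.isPath_tail.isHamiltonian_of_mem fun x => ?_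
    rw [SimpleGraph.Walk.support_tail_of_not_nil _ hp'.not_nil]
    have hx : x ∈ (p.mapLe (le_top : G ≤ SimpleGraph.completeGraph V)).support := by
      simpa using hmem x
    rw [SimpleGraph.Walk.mem_support_iff] at hx
    rcases hx with rfl | hx
    · exact SimpleGraph.Walk.end_mem_tail_support hp'.not_nil
    · exact hx
  · have : G.LocallyFinite := fun x => Fintype.ofFinite _
    have := hp.adj_toSubgraph_iff_of_isCycles hcyc (hmem x) y
    rw [SimpleGraph.Walk.mem_edgeSet, SimpleGraph.Walk.edges_mapLe_eq_edges,
      ← SimpleGraph.Walk.mem_edges_toSubgraph, SimpleGraph.Subgraph.mem_edgeSet, this]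
    exact Iff.rfl

theorem PairJoin.hasPHProperty [Finite V] {G : SimpleGraph V} (h : PairJoin G.Adj)
    (hV : Even (Nat.card V)) (hV' : 3 ≤ Nat.card V) : G.HasPHProperty := by
  refine ⟨hV, fun M hM => ?_⟩
  obtain ⟨m, hm, hMm⟩ := hM.exists_isPairing
  obtain ⟨n, ⟨hn, hG⟩, hj⟩ := h m hm
  obtain ⟨N, hN, hNn⟩ := hn.exists_isPerfectMatching hG
  obtain ⟨v, C, hC, hedge⟩ := hj.exists_isHamiltonianCycle hV' hm hn
  refine ⟨N, hN, v, C, hC, ?_⟩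
  ext e
  induction e using Sym2.ind with
  | _ x y => rw [hedge, ← hMm, ← hNn]; rfl

theorem two_pow_le_card_prismVertex [Finite V] [Nonempty V] (k : ℕ) :
    2 ^ k ≤ Nat.card (PrismVertex V k) := by
  induction k with
  | zero => exact Nat.card_pos (α := V)
  | succ k ih =>
    have : Nat.card (PrismVertex V (k + 1)) = Nat.card (PrismVertex V k) * 2 :=
      (Nat.card_prod _ _).trans (by simp)
    rw [this, pow_succ]
    exact Nat.mul_le_mul_right 2 ih

end Hamiltonian

theorem mainTheorem3 {V : Type*} [Finite V] (G : SimpleGraph V) (hG : G.IsTraceable)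
    (k : ℕ) (hk : 5 ≤ k) : (G.prismPow k).HasPHProperty := by
  have : Nonempty V := hG.elim fun u _ => ⟨u⟩
  -- Three prisms supply the cube factor; the other `j` are handled by the prism step.
  obtain ⟨j, rfl⟩ := Nat.exists_eq_add_of_le (show 2 + 1 ≤ k by omega)
  refine (SimpleGraph.pairJoin_prismPow_add (k := 2)
    hG.pairJoin_prism_prism_prism j).hasPHProperty ?_ ?_
  · have := even_card_prismVertex (V := V) (2 + j)
    rwa [Nat.add_right_comm] at this
  · have h₁ := two_pow_le_card_prismVertex (V := V) (2 + 1 + j)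
    have h₂ := Nat.pow_le_pow_right (n := 2) (by omega) (show 2 ≤ 2 + 1 + j by omega)
    omega
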